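/- Let $\mathbb{T}^2 = \mathbb{R}^2/\mathbb{Z}^2$, let $A \in GL(2,\mathbb{Z})$ be hyperbolic, i.e. no complex eigenvalue of $A$ has modulus $1$ (the determinant may be $1$ or $-1$), and write $A : \mathbb{T}^2 \to \mathbb{T}^2$ also for the induced hyperbolic toral automorphism. Let $M_A$ be the suspension manifold of $A$, that is, the quotient space $$M_A = (\mathbb{T}^2 \times \mathbb{R})/{\sim}$$ by the equivalence relation generated by $(Ax, t) \sim (x, t+1)$ for $x \in \mathbb{T}^2$, $t \in \mathbb{R}$. Then for every homeomorphism $f : M_A \to M_A$ there is an integer $n \ge 1$ such that the iterate $f^n$ is homotopic to the identity map of $M_A$. -/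

import Mathlib

/-- An integer matrix in `GL(2, ℤ)` (so its determinant is `1` or `-1`) is hyperbolic if none of its
complex eigenvalues has modulus one. -/
def IsHyperbolicMatrix (A : GL (Fin 2) ℤ) : Prop :=
  ∀ μ ∈ spectrum ℂ ((A : Matrix (Fin 2) (Fin 2) ℤ).map (Int.cast : ℤ → ℂ)), ‖μ‖ ≠ 1

/-- The endomorphism `x ↦ M x` of the torus `𝕋² = (ℝ/ℤ)²` given by an integer matrix `M`. -/
def toralMap (M : Matrix (Fin 2) (Fin 2) ℤ) (x : UnitAddTorus (Fin 2)) : UnitAddTorus (Fin 2) :=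
  fun i => ∑ j, M i j • x j

theorem toralMap_one (x : UnitAddTorus (Fin 2)) : toralMap 1 x = x := by
  funext i
  simp [toralMap, Matrix.one_apply, ite_smul]

theorem toralMap_mul (M N : Matrix (Fin 2) (Fin 2) ℤ) (x : UnitAddTorus (Fin 2)) :
    toralMap (M * N) x = toralMap M (toralMap N x) := by
  funext i
  simp only [toralMap, Matrix.mul_apply, Fin.sum_univ_two, add_smul, mul_smul, smul_add]
  abel

theorem continuous_toralMap (M : Matrix (Fin 2) (Fin 2) ℤ) : Continuous (toralMap M) := by
  unfold toralMap
  fun_prop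

/-- The toral automorphism of `𝕋² = (ℝ/ℤ)²` induced by a matrix `A` in `GL(2, ℤ)`. -/
def toralAut (A : GL (Fin 2) ℤ) : UnitAddTorus (Fin 2) ≃ₜ+ UnitAddTorus (Fin 2) where
  toFun := toralMap A
  invFun := toralMap ((A⁻¹ : GL (Fin 2) ℤ) : Matrix (Fin 2) (Fin 2) ℤ)
  left_inv x := by rw [← toralMap_mul, Units.inv_mul, toralMap_one]
  right_inv x := by rw [← toralMap_mul, Units.mul_inv, toralMap_one]
  map_add' x y := by
    funext i
    simp [toralMap, smul_add, Finset.sum_add_distrib]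
  continuous_toFun := continuous_toralMap _
  continuous_invFun := continuous_toralMap _

/-- The identification `(A x, t) ∼ (x, t + 1)` on `𝕋² × ℝ`. -/
inductive SuspensionRel (A : GL (Fin 2) ℤ) :
    UnitAddTorus (Fin 2) × ℝ → UnitAddTorus (Fin 2) × ℝ → Prop
  | glue (x : UnitAddTorus (Fin 2)) (t : ℝ) : SuspensionRel A (toralAut A x, t) (x, t + 1)

/-- The suspension `M_A = 𝕋² × ℝ / ∼`: the quotient space of `𝕋² × ℝ` by the equivalence relation
generated by `(A x, t) ∼ (x, t + 1)`, with the quotient topology. -/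
abbrev SuspensionManifold (A : GL (Fin 2) ℤ) : Type := Quot (SuspensionRel A)

/-!
The suspension `M_A` is the quotient of the vector space `ℝ² × ℝ` by the group `G = ℤ² ⋊ ℤ`
(`DeckGroup`), which acts freely, properly discontinuously and by affine maps
(`isQuotientCoveringMap_suspensionMk`). A homeomorphism `f` of `M_A` lifts to a self-map of
`ℝ² × ℝ` that is equivariant up to an automorphism `φ` of `G`. If `φ ^ n` is inner, then the lift of
`f ^ n` can be corrected by a deck transformation so as to commute with `G`, and the straight-line
homotopy from it to the identity descends to `M_A`, because `G` preserves affine combinations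
(`IsQuotientCoveringMap.exists_pow_homotopic_id`).

It remains to see that every automorphism `φ` of `G` has an inner power
(`DeckGroup.exists_pow_mem_range_conj_of_mulAut`). As `A` does not have the eigenvalue `1`, the
subgroup `ℤ²` lies in the kernel of every homomorphism `G → ℤ`; so `φ` preserves `ℤ²` and acts
on `G / ℤ² = ℤ` by `±1`. Its square then acts on `ℤ²` by a matrix `B` that commutes with `A`. The
centralizer of a hyperbolic matrix has rank one, so `B ^ n = A ^ l` for some `n ≥ 1`
(`IsHyperbolicMatrix.exists_pow_eq_zpow`), and up to conjugation by an element of level `l` the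
automorphism `φ ^ (2 * n)` is trivial on `ℤ²` and on `ℤ`. Such an automorphism is a class in the
finite group `ℤ² / (A⁻¹ - 1) ℤ²`, hence has an inner power.
-/

/-! ### Lifting self-maps through a quotient covering map -/

section Lifting

variable {E X G : Type*} [TopologicalSpace E] [Group G] [MulAction G E]

/-- The self-map `F` of the total space `E` of `p : E → X` lies over the self-map `f` of `X`, and it
intertwines the action of `G` on `E` with its twist by the endomorphism `φ` of `G`. -/
structure IsTwistedLift (p : E → X) (f : X → X) (F : E → E) (φ : G → G) : Prop where
  continuous : Continuous F
  proj : ∀ e, p (F e) = f (p e)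
  map_smul : ∀ g e, F (g • e) = φ g • F e

namespace IsTwistedLift

theorem comp {p : E → X} {f f' : X → X} {F F' : E → E} {φ φ' : G → G}
    (h : IsTwistedLift p f F φ) (h' : IsTwistedLift p f' F' φ') :
    IsTwistedLift p (f ∘ f') (F ∘ F') (φ ∘ φ') where
  continuous := h.continuous.comp h'.continuous
  proj e := by simp [h.proj, h'.proj]
  map_smul g e := by simp [h.map_smul, h'.map_smul]

theorem iterate {p : E → X} {f : X → X} {F : E → E} {φ : G → G}
    (h : IsTwistedLift p f F φ) (n : ℕ) : IsTwistedLift p f^[n] F^[n] φ^[n] := by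
  induction n with
  | zero => exact ⟨continuous_id, fun _ => rfl, fun _ _ => rfl⟩
  | succ n ih =>
    rw [Function.iterate_succ, Function.iterate_succ, Function.iterate_succ]
    exact ih.comp h

end IsTwistedLift

namespace IsQuotientCoveringMap

variable [TopologicalSpace X] {p : E → X} (hp : IsQuotientCoveringMap p G)
include hp

theorem smul_left_cancel {g h : G} {e : E} (H : g • e = h • e) : g = h :=
  have := hp.isCancelSMul
  IsCancelSMul.right_cancel _ _ e H

/-- Two lifts of the same map on a connected space differ by one deck transformation. -/
theorem exists_eq_smul_of_comp_eq [ConnectedSpace E] {F F' : E → E}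
    (hF : Continuous F) (hF' : Continuous F') (H : ∀ e, p (F e) = p (F' e)) :
    ∃ g : G, ∀ e, F e = g • F' e := by
  have := hp.toContinuousConstSMul
  obtain ⟨e₀⟩ := (inferInstance : Nonempty E)
  obtain ⟨g, hg⟩ := hp.apply_eq_iff_mem_orbit.mp (H e₀)
  refine ⟨g, fun e =>
    congrFun (hp.isCoveringMap.eq_of_comp_eq hF (hF'.const_smul g) ?_ e₀ hg.symm) e⟩
  funext e
  simp [hp.map_smul, H]


/-- A lift of the identity is a deck transformation, so its twist is conjugation by it. -/
theorem exists_twist_eq_conj [ConnectedSpace E] {F : E → E} {φ : G → G}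
    (h : IsTwistedLift p id F φ) :
    ∃ a : G, ∀ g, φ g = a * g * a⁻¹ := by
  obtain ⟨e₀⟩ := (inferInstance : Nonempty E)
  obtain ⟨a, ha⟩ := hp.exists_eq_smul_of_comp_eq h.continuous continuous_id h.proj
  refine ⟨a, fun g => eq_mul_inv_of_mul_eq (hp.smul_left_cancel (e := e₀) ?_)⟩
  have := h.map_smul g e₀
  simpa [ha, mul_smul] using this.symm

variable [SimplyConnectedSpace E] [LocallyPathConnectedSpace E]

/-- Every continuous self-map of the base of a universal covering lifts to a map that is
equivariant up to an endomorphism of the deck group. -/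
theorem exists_isTwistedLift {f : X → X} (hf : Continuous f) :
    ∃ (F : E → E) (φ : G →* G), IsTwistedLift p f F φ := by
  have := hp.toContinuousConstSMul
  obtain ⟨e₀⟩ := (inferInstance : Nonempty E)
  obtain ⟨e₁, he₁⟩ := hp.surjective (f (p e₀))
  obtain ⟨F, ⟨-, hF⟩, -⟩ := hp.isCoveringMap.existsUnique_continuousMap_lifts
    ((⟨f, hf⟩ : C(X, X)).comp ⟨p, hp.continuous⟩) e₀ e₁ he₁
  have hF (e : E) : p (F e) = f (p e) := congrFun hF e
  have key (g : G) : ∃ h : G, ∀ e, F (g • e) = h • F e :=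
    hp.exists_eq_smul_of_comp_eq (F.continuous.comp (continuous_const_smul g)) F.continuous
      fun e => by rw [hF, hF, hp.map_smul]
  choose φ hφ using key
  refine ⟨F, MonoidHom.mk' φ fun g h => hp.smul_left_cancel (e := F e₀) ?_, F.continuous, hF, hφ⟩
  rw [← hφ, mul_smul, mul_smul, hφ, hφ]

/-- The twist of a lift of a homeomorphism is bijective: composed with the twist of a lift of the
inverse, on either side, it is an inner automorphism. -/
theorem exists_isTwistedLift_mulEquiv (f : X ≃ₜ X) :
    ∃ (F : E → E) (φ : MulAut G), IsTwistedLift p f F φ := by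
  obtain ⟨F, φ, h⟩ := hp.exists_isTwistedLift f.continuous
  obtain ⟨F', φ', h'⟩ := hp.exists_isTwistedLift f.symm.continuous
  have h₁ := h.comp h'
  have h₂ := h'.comp h
  rw [f.self_comp_symm] at h₁
  rw [f.symm_comp_self] at h₂
  obtain ⟨a, ha⟩ := hp.exists_twist_eq_conj h₁
  obtain ⟨b, hb⟩ := hp.exists_twist_eq_conj h₂
  have inj : Function.Injective φ := fun g g' H => by
    have := (hb g).symm.trans ((congrArg φ' H).trans (hb g'))
    simpa using this
  have surj : Function.Surjective φ := fun g => ⟨φ' (a⁻¹ * g * a), by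
    have := ha (a⁻¹ * g * a)
    simpa [mul_assoc] using this⟩
  exact ⟨F, MulEquiv.ofBijective φ ⟨inj, surj⟩, h⟩

end IsQuotientCoveringMap

end Lifting

/-! ### Quotients of vector spaces by affine actions -/

section Affine

variable {E X G : Type*} [NormedAddCommGroup E] [NormedSpace ℝ E] [TopologicalSpace X] [Group G]
  [MulAction G E] {p : E → X}

/-- The straight-line homotopy from `F` to the identity is equivariant when `F` is, because deck
transformations preserve affine combinations; so it descends to the quotient. -/
theorem IsQuotientCoveringMap.homotopic_id_of_lift (hp : IsQuotientCoveringMap p G)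
    (haff : ∀ (g : G) (s : ℝ) (x y : E),
      g • AffineMap.lineMap x y s = AffineMap.lineMap (g • x) (g • y) s)
    {f : C(X, X)} {F : E → E} (h : IsTwistedLift p f F (id : G → G)) :
    f.Homotopic (ContinuousMap.id X) := by
  let H : unitInterval × E → X := fun q => p (AffineMap.lineMap (F q.2) q.2 (q.1 : ℝ))
  have hH : Continuous H := by
    refine hp.continuous.comp ?_
    simp only [AffineMap.lineMap_apply_module]
    have := h.continuous
    fun_prop
  have hq : IsOpenQuotientMap (Prod.map id p : unitInterval × E → unitInterval × X) :=
    IsOpenQuotientMap.id.prodMap hp.isOpenQuotientMap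
  have hfac : Function.FactorsThrough H (Prod.map id p : unitInterval × E → unitInterval × X) := by
    rintro ⟨s, x⟩ ⟨s', y⟩ hxy
    have hs : s = s' := congrArg Prod.fst hxy
    have hxy : p x = p y := congrArg Prod.snd hxy
    obtain ⟨g, rfl⟩ := hp.apply_eq_iff_mem_orbit.mp hxy
    subst hs
    simp only [H, h.map_smul, id, ← haff, hp.map_smul]
  let π : C(unitInterval × E, unitInterval × X) := ⟨Prod.map id p, hq.continuous⟩
  have hπ : Topology.IsQuotientMap π := hq.isQuotientMap
  let K : C(unitInterval × X, X) := hπ.lift ⟨H, hH⟩ hfac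
  have hK (s : unitInterval) (e : E) : K (s, p e) = H (s, e) :=
    congrArg (fun k : C(unitInterval × E, X) => k (s, e)) (hπ.lift_comp ⟨H, hH⟩ hfac)
  refine ⟨⟨K, fun x => ?_, fun x => ?_⟩⟩
  · obtain ⟨e, rfl⟩ := hp.surjective x
    simpa [H, h.proj] using hK 0 e
  · obtain ⟨e, rfl⟩ := hp.surjective x
    simpa [H] using hK 1 e

/-- A quotient of a vector space by a free, properly discontinuous affine action of a group `G` is
aspherical, so its homeomorphisms are governed up to homotopy by the outer automorphisms of `G`. -/
theorem IsQuotientCoveringMap.exists_pow_homotopic_id (hp : IsQuotientCoveringMap p G)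
    (haff : ∀ (g : G) (s : ℝ) (x y : E),
      g • AffineMap.lineMap x y s = AffineMap.lineMap (g • x) (g • y) s)
    (hG : ∀ φ : MulAut G, ∃ n : ℕ, 1 ≤ n ∧ φ ^ n ∈ (MulAut.conj : G →* MulAut G).range)
    (f : X ≃ₜ X) :
    ∃ n : ℕ, 1 ≤ n ∧ ContinuousMap.Homotopic ((f ^ n : X ≃ₜ X) : C(X, X)) (ContinuousMap.id X) := by
  have := hp.toContinuousConstSMul
  have : LocallyPathConnectedSpace E := inferInstance
  obtain ⟨F, φ, h⟩ := hp.exists_isTwistedLift_mulEquiv f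
  obtain ⟨n, hn, a, ha⟩ := hG φ
  refine ⟨n, hn, hp.homotopic_id_of_lift haff (F := fun e => a⁻¹ • F^[n] e) ?_⟩
  have hφ (k : ℕ) : (φ : G → G)^[k] = (φ ^ k : MulAut G) := by
    induction k with
    | zero => rfl
    | succ k ih => rw [Function.iterate_succ, ih, pow_succ]; rfl
  have hf (k : ℕ) : (f : X → X)^[k] = (f ^ k : X ≃ₜ X) := by
    induction k with
    | zero => rfl
    | succ k ih => rw [Function.iterate_succ, ih, pow_succ]; rfl
  have hn' := h.iterate n
  rw [hφ, ← ha, hf] at hn'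
  refine ⟨hn'.continuous.const_smul _, fun e => ?_, fun g e => ?_⟩
  · rw [hp.map_smul, hn'.proj]
    rfl
  · rw [hn'.map_smul, MulAut.conj_apply, smul_smul, id, smul_smul]
    group

end Affine

/-! ### Hyperbolic integer matrices -/

theorem Matrix.GeneralLinearGroup.det_fin_two_eq_one_or_neg_one (A : GL (Fin 2) ℤ) :
    A 0 0 * A 1 1 - A 0 1 * A 1 0 = 1 ∨ A 0 0 * A 1 1 - A 0 1 * A 1 0 = -1 := by
  have := Int.isUnit_iff.mp ((Matrix.isUnit_iff_isUnit_det _).mp A.isUnit)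
  rwa [Matrix.det_fin_two] at this

namespace IsHyperbolicMatrix

variable {A : GL (Fin 2) ℤ} (hA : IsHyperbolicMatrix A)
include hA

theorem norm_ne_one {μ : ℂ}
    (h : (μ - A 0 0) * (μ - A 1 1) - A 0 1 * A 1 0 = 0) : ‖μ‖ ≠ 1 := by
  refine hA μ ?_
  rw [spectrum.mem_iff, Matrix.isUnit_iff_isUnit_det, Matrix.det_fin_two]
  simpa [Matrix.algebraMap_matrix_apply] using h

theorem abs_ne_one {x : ℝ}
    (h : (x - A 0 0) * (x - A 1 1) - A 0 1 * A 1 0 = 0) : |x| ≠ 1 := by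
  have := hA.norm_ne_one (μ := x) (by exact_mod_cast congrArg (fun y : ℝ => (y : ℂ)) h)
  simpa using this

/-- If the discriminant of the characteristic polynomial were nonpositive, its two roots would be
complex conjugates of product `det A = 1`, hence of modulus `1`. -/
theorem discr_pos : 0 < ((A 0 0 + A 1 1 : ℤ) : ℝ) ^ 2
    - 4 * (A 0 0 * A 1 1 - A 0 1 * A 1 0 : ℤ) := by
  by_contra! H
  set t : ℤ := A 0 0 + A 1 1 with ht
  have hd : A 0 0 * A 1 1 - A 0 1 * A 1 0 = 1 := by
    rcases A.det_fin_two_eq_one_or_neg_one with h | h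
    · exact h
    · rw [h] at H
      push_cast at H
      nlinarith [sq_nonneg (t : ℝ)]
  rw [hd] at H
  push_cast at H
  set s : ℝ := Real.sqrt (4 - (t : ℝ) ^ 2)
  have hs : s ^ 2 = 4 - (t : ℝ) ^ 2 := Real.sq_sqrt (by linarith)
  have hdC : (A 0 0 : ℂ) * A 1 1 - A 0 1 * A 1 0 = 1 := by exact_mod_cast hd
  have htC : (t : ℂ) = A 0 0 + A 1 1 := by rw [ht]; push_cast; rfl
  have hsC : (s : ℂ) ^ 2 = 4 - (t : ℂ) ^ 2 := by exact_mod_cast congrArg (fun y : ℝ => (y : ℂ)) hs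
  refine hA.norm_ne_one (μ := ((t : ℝ) / 2 : ℝ) + (s / 2 : ℝ) * Complex.I) ?_ ?_
  · push_cast
    linear_combination hdC + (t / 2 + s / 2 * Complex.I) * htC
      + (s : ℂ) ^ 2 / 4 * Complex.I_sq - hsC / 4
  · rw [← sq_eq_sq₀ (norm_nonneg _) zero_le_one, ← Complex.normSq_eq_norm_sq,
      Complex.normSq_add_mul_I]
    linear_combination hs / 4

theorem apply_zero_one_ne_zero : A 0 1 ≠ 0 := by
  intro hb
  have h1 : |((A 0 0 : ℤ) : ℝ)| ≠ 1 := hA.abs_ne_one (by simp [hb])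
  have : IsUnit (A 0 0) := by
    rcases A.det_fin_two_eq_one_or_neg_one with h | h
    · exact IsUnit.of_mul_eq_one (A 1 1) (by linear_combination h + A 1 0 * hb)
    · exact IsUnit.of_mul_eq_one (-A 1 1) (by linear_combination -h - A 1 0 * hb)
  rcases Int.isUnit_iff.mp this with h | h <;> simp [h] at h1

theorem det_inv_sub_one_ne_zero :
    (((A⁻¹ : GL (Fin 2) ℤ) : Matrix (Fin 2) (Fin 2) ℤ) - 1).det ≠ 0 := by
  intro h
  have h' : ((A : Matrix (Fin 2) (Fin 2) ℤ) - 1).det = 0 := by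
    have : (A : Matrix (Fin 2) (Fin 2) ℤ) - 1
        = -((A : Matrix (Fin 2) (Fin 2) ℤ) * (((A⁻¹ : GL (Fin 2) ℤ) : Matrix _ _ ℤ) - 1)) := by
      rw [mul_sub, ← Units.val_mul, mul_inv_cancel]
      simp
    rw [this, Matrix.det_neg, Matrix.det_mul, h]
    simp
  rw [Matrix.det_fin_two] at h'
  refine hA.abs_ne_one (x := 1) ?_ abs_one
  simp at h'
  have : ((((A 0 0 - 1) * (A 1 1 - 1) - A 0 1 * A 1 0 : ℤ)) : ℝ) = 0 := by exact_mod_cast h'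
  push_cast at this
  linear_combination this

/-- The slopes `w`, `w'` of the two eigenlines of a hyperbolic matrix, the first one expanded. -/
theorem exists_slopes : ∃ w w' : ℝ, w ≠ w' ∧ 1 < |A 0 0 + A 0 1 * w| ∧
    (A 0 1 : ℝ) * (w + w') = A 1 1 - A 0 0 ∧ (A 0 1 : ℝ) * (w * w') = -A 1 0 := by
  have hb : (A 0 1 : ℝ) ≠ 0 := by exact_mod_cast hA.apply_zero_one_ne_zero
  have hD := hA.discr_pos
  set D := ((A 0 0 + A 1 1 : ℤ) : ℝ) ^ 2 - 4 * (A 0 0 * A 1 1 - A 0 1 * A 1 0 : ℤ) with hDdef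
  have hs : Real.sqrt D ^ 2 = D := Real.sq_sqrt hD.le
  have hs0 : 0 < Real.sqrt D := Real.sqrt_pos.mpr hD
  set s := Real.sqrt D
  push_cast at hDdef
  rw [hDdef] at hs
  let w : ℝ := (A 1 1 - A 0 0 + s) / (2 * A 0 1)
  let w' : ℝ := (A 1 1 - A 0 0 - s) / (2 * A 0 1)
  have h1 : (A 0 1 : ℝ) * w = (A 1 1 - A 0 0 + s) / 2 := by simp only [w]; field_simp
  have h2 : (A 0 1 : ℝ) * w' = (A 1 1 - A 0 0 - s) / 2 := by simp only [w']; field_simp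
  have hne : w ≠ w' := by
    intro h
    rw [← h, h1] at h2
    linarith
  have hsum : (A 0 1 : ℝ) * (w + w') = A 1 1 - A 0 0 := by rw [mul_add, h1, h2]; ring
  have hprod : (A 0 1 : ℝ) * (w * w') = -A 1 0 := by
    apply mul_left_cancel₀ hb
    linear_combination (A 0 1 * w') * h1 + (A 1 1 - A 0 0 + s) / 2 * h2 - hs / 4
  have hmul : (A 0 0 + A 0 1 * w) * (A 0 0 + A 0 1 * w') =
      ((A 0 0 * A 1 1 - A 0 1 * A 1 0 : ℤ) : ℝ) := by
    push_cast
    linear_combination A 0 0 * hsum + A 0 1 * hprod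
  have habs : |A 0 0 + A 0 1 * w| * |A 0 0 + A 0 1 * w'| = 1 := by
    rw [← abs_mul, hmul]
    rcases A.det_fin_two_eq_one_or_neg_one with h | h <;> simp [h]
  have hne1 : |A 0 0 + A 0 1 * w| ≠ 1 := by
    refine hA.abs_ne_one ?_
    rw [h1]
    linear_combination hs / 4
  rcases lt_or_gt_of_ne hne1 with hlt | hgt
  · refine ⟨w', w, hne.symm, ?_, by rw [← hsum]; ring, by rw [← hprod]; ring⟩
    by_contra! hle
    have : |A 0 0 + A 0 1 * w| * |A 0 0 + A 0 1 * w'| < 1 :=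
      mul_lt_one_of_nonneg_of_lt_one_left (abs_nonneg _) hlt hle
    linarith
  · exact ⟨w, w', hne, hgt, hsum, hprod⟩

end IsHyperbolicMatrix

/-! ### Centralizers of hyperbolic matrices -/

theorem Matrix.GeneralLinearGroup.commute_entries {A C : GL (Fin 2) ℤ} (hC : C * A = A * C) :
    C 0 1 * A 1 0 = A 0 1 * C 1 0 ∧
      C 0 0 * A 0 1 + C 0 1 * A 1 1 = A 0 0 * C 0 1 + A 0 1 * C 1 1 := by
  have h00 : (C * A) 0 0 = (A * C) 0 0 := by rw [hC]
  have h01 : (C * A) 0 1 = (A * C) 0 1 := by rw [hC]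
  simp only [Matrix.GeneralLinearGroup.coe_mul, Matrix.mul_apply, Fin.sum_univ_two] at h00 h01
  exact ⟨by linear_combination h00, h01⟩

/-- A matrix that commutes with `A` preserves each eigenline of `A`. If `(1, w)` spans an
eigenline, `eigenvalueHom` sends such a matrix to its eigenvalue on that line. The hypothesis `hw`
says that `(1, w)` is an eigenvector. -/
def eigenvalueHom (A : GL (Fin 2) ℤ) (w : ℝ) (hb : A 0 1 ≠ 0)
    (hw : (A 0 1 : ℝ) * w ^ 2 = (A 1 1 - A 0 0) * w + A 1 0) :
    Subgroup.centralizer {A} →* ℝ where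
  toFun B := (B : GL (Fin 2) ℤ) 0 0 + (B : GL (Fin 2) ℤ) 0 1 * w
  map_one' := by simp
  map_mul' := by
    rintro ⟨B, hB⟩ ⟨C, hC⟩
    obtain ⟨h00, h01⟩ := Matrix.GeneralLinearGroup.commute_entries
      (Subgroup.mem_centralizer_singleton_iff.mp hC)
    have h00 : (C 0 1 * A 1 0 : ℝ) = A 0 1 * C 1 0 := by exact_mod_cast h00
    have h01 : (C 0 0 * A 0 1 + C 0 1 * A 1 1 : ℝ) = A 0 0 * C 0 1 + A 0 1 * C 1 1 := by
      exact_mod_cast h01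
    have hb : (A 0 1 : ℝ) ≠ 0 := by exact_mod_cast hb
    have key : (C 1 0 + C 1 1 * w : ℝ) = (C 0 0 + C 0 1 * w) * w := by
      apply mul_left_cancel₀ hb
      linear_combination -h00 - h01 * w - C 0 1 * hw
    simp only [MulMemClass.mk_mul_mk, Matrix.GeneralLinearGroup.coe_mul,
      Matrix.mul_apply, Fin.sum_univ_two]
    push_cast
    linear_combination B 0 1 * key

/-- The centralizer of a hyperbolic matrix has rank one. The two eigenvalues of an element of the
centralizer have product `±1`; multiplying a power of `B` by a power of `A` brings both into a
bounded region, and only finitely many integer matrices commuting with `A` have eigenvalues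
there. -/
theorem IsHyperbolicMatrix.exists_pow_eq_zpow {A : GL (Fin 2) ℤ} (hA : IsHyperbolicMatrix A)
    {B : GL (Fin 2) ℤ} (hB : B * A = A * B) : ∃ n : ℕ, 1 ≤ n ∧ ∃ l : ℤ, B ^ n = A ^ l := by
  obtain ⟨w, w', hne, hlt, hsum, hprod⟩ := hA.exists_slopes
  have hb := hA.apply_zero_one_ne_zero
  let χ := eigenvalueHom A w hb (by linear_combination w * hsum - hprod)
  let χ' := eigenvalueHom A w' hb (by linear_combination w' * hsum - hprod)
  have hχ (C) : χ C = (C : GL (Fin 2) ℤ) 0 0 + (C : GL (Fin 2) ℤ) 0 1 * w := rfl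
  have hχ' (C) : χ' C = (C : GL (Fin 2) ℤ) 0 0 + (C : GL (Fin 2) ℤ) 0 1 * w' := rfl
  have hbR : (A 0 1 : ℝ) ≠ 0 := by exact_mod_cast hb
  have hmul (C : Subgroup.centralizer {A}) : |χ C| * |χ' C| = 1 := by
    obtain ⟨C, hC⟩ := C
    obtain ⟨h00, h01⟩ := Matrix.GeneralLinearGroup.commute_entries
      (Subgroup.mem_centralizer_singleton_iff.mp hC)
    have h00 : (C 0 1 * A 1 0 : ℝ) = A 0 1 * C 1 0 := by exact_mod_cast h00
    have h01 : (C 0 0 * A 0 1 + C 0 1 * A 1 1 : ℝ) = A 0 0 * C 0 1 + A 0 1 * C 1 1 := by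
      exact_mod_cast h01
    have : χ ⟨C, hC⟩ * χ' ⟨C, hC⟩ = ((C 0 0 * C 1 1 - C 0 1 * C 1 0 : ℤ) : ℝ) := by
      simp only [hχ, hχ']
      push_cast
      apply mul_left_cancel₀ hbR
      linear_combination C 0 0 * C 0 1 * hsum + C 0 1 ^ 2 * hprod + C 0 0 * h01 - C 0 1 * h00
    rw [← abs_mul, this]
    rcases C.det_fin_two_eq_one_or_neg_one with h | h <;> simp [h]
  let a : Subgroup.centralizer {A} := ⟨A, Subgroup.mem_centralizer_singleton_iff.mpr rfl⟩
  let b : Subgroup.centralizer {A} := ⟨B, Subgroup.mem_centralizer_singleton_iff.mpr hB⟩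
  have hlt : 1 < |χ a| := hlt
  have hfin : {C : Subgroup.centralizer {A} | |χ C| ≤ |χ a| ∧ |χ' C| ≤ 1}.Finite := by
    -- The two eigenvalues `p + q w` and `p + q w'` bound the first row `(p, q)`, as `w ≠ w'`.
    set Q := (|χ a| + 1) / |w - w'|
    set P := |χ a| + Q * |w|
    refine Set.Finite.of_injOn
      (f := fun C : Subgroup.centralizer {A} => ((C : GL (Fin 2) ℤ) 0 0, (C : GL (Fin 2) ℤ) 0 1))
      (t := Set.Icc (-⌊P⌋) ⌊P⌋ ×ˢ Set.Icc (-⌊Q⌋) ⌊Q⌋) ?_ ?_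
      ((Set.finite_Icc _ _).prod (Set.finite_Icc _ _))
    · rintro C ⟨h1, h2⟩
      set p := (C : GL (Fin 2) ℤ) 0 0 with hp
      set q := (C : GL (Fin 2) ℤ) 0 1 with hq
      have hqQ : |(q : ℝ)| ≤ Q := by
        rw [le_div_iff₀ (abs_pos.mpr (sub_ne_zero.mpr hne)), ← abs_mul]
        have : (q : ℝ) * (w - w') = χ C - χ' C := by rw [hχ, hχ', ← hp, ← hq]; ring
        rw [this]
        exact (abs_sub _ _).trans (add_le_add h1 h2)
      have hpP : |(p : ℝ)| ≤ P := by
        have : (p : ℝ) = χ C - q * w := by rw [hχ, ← hp, ← hq]; ring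
        rw [this]
        refine (abs_sub _ _).trans (add_le_add h1 ?_)
        rw [abs_mul]
        gcongr
      refine ⟨abs_le.mp (Int.le_floor.mpr ?_), abs_le.mp (Int.le_floor.mpr ?_)⟩
      · simpa using hpP
      · simpa using hqQ
    · -- The second row is determined by the first one, as `A 0 1 ≠ 0`.
      rintro ⟨C, hC⟩ - ⟨D, hD⟩ - h
      obtain ⟨hp, hq⟩ := Prod.mk.inj h
      obtain ⟨h1, h2⟩ := Matrix.GeneralLinearGroup.commute_entries
        (Subgroup.mem_centralizer_singleton_iff.mp hC)
      obtain ⟨h3, h4⟩ := Matrix.GeneralLinearGroup.commute_entries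
        (Subgroup.mem_centralizer_singleton_iff.mp hD)
      have hp : C 0 0 = D 0 0 := hp
      have hq : C 0 1 = D 0 1 := hq
      have hr : C 1 0 = D 1 0 := mul_left_cancel₀ hb (by linear_combination h3 - h1 + A 1 0 * hq)
      have hs : C 1 1 = D 1 1 := mul_left_cancel₀ hb (by
        linear_combination h4 - h2 + A 0 1 * hp + (A 1 1 - A 0 0) * hq)
      refine Subtype.ext (Units.ext (Matrix.ext fun i j => ?_))
      fin_cases i <;> fin_cases j <;> assumption
  have hpos (C : Subgroup.centralizer {A}) : 0 < |χ C| :=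
    abs_pos.mpr fun h => by simpa [h] using hmul C
  have hl (n : ℕ) : ∃ l : ℤ, b ^ n * a ^ (-l) ∈
      {C : Subgroup.centralizer {A} | |χ C| ≤ |χ a| ∧ |χ' C| ≤ 1} := by
    obtain ⟨l, hl1, hl2⟩ := exists_mem_Ico_zpow (hpos (b ^ n)) hlt
    have ha : 0 < |χ a| ^ l := zpow_pos (hpos a) l
    have hval : |χ (b ^ n * a ^ (-l))| = |χ (b ^ n)| / |χ a| ^ l := by
      rw [map_mul, map_zpow, abs_mul, abs_zpow, zpow_neg, div_eq_mul_inv]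
    have h1 : 1 ≤ |χ (b ^ n * a ^ (-l))| := by rwa [hval, one_le_div ha]
    refine ⟨l, ?_, ?_⟩
    · rw [hval, div_le_iff₀ ha, ← zpow_one_add₀ (hpos a).ne', add_comm]
      exact hl2.le
    · rw [← hmul (b ^ n * a ^ (-l))]
      exact le_mul_of_one_le_left (abs_nonneg _) h1
  choose l hl using hl
  -- By the pigeonhole principle two of the matrices `B ^ n * A ^ (-l n)` coincide.
  obtain ⟨m, -, n, -, hmn, h⟩ := Set.infinite_univ.exists_lt_map_eq_of_mapsTo
    (f := fun n : ℕ => b ^ n * a ^ (-l n)) (fun n _ => hl n) hfin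
  obtain ⟨k, rfl⟩ := Nat.exists_eq_add_of_lt hmn
  refine ⟨k + 1, by omega, l (m + k + 1) - l m, ?_⟩
  have h : B ^ m * A ^ (-l m) = B ^ (m + (k + 1)) * A ^ (-l (m + k + 1)) := congrArg Subtype.val h
  rw [pow_add, mul_assoc, mul_right_inj, zpow_neg, zpow_neg, eq_mul_inv_iff_mul_eq] at h
  rw [sub_eq_neg_add, zpow_add, zpow_neg, h]

/-! ### The deck group of the suspension -/

/-- The group `ℤ² ⋊ ℤ` of deck transformations of `ℝ² × ℝ` over the suspension of `A`: the element
`(m, k)` stands for `(v, t) ↦ (A⁻ᵏ v + m, t + k)`. -/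
@[ext]
structure DeckGroup (A : GL (Fin 2) ℤ) where
  /-- The translation part in the `ℤ²` direction. -/
  trans : Fin 2 → ℤ
  /-- The translation part in the flow direction. -/
  level : ℤ

namespace DeckGroup

open scoped Matrix

open Matrix (mulVec_mulVec mulVec_zero mulVec_add mulVec_neg sub_mulVec one_mulVec smul_mulVec 
  mul_adjugate ext_of_mulVec_single)

variable {A : GL (Fin 2) ℤ}

instance : Mul (DeckGroup A) :=
  ⟨fun g h => ⟨g.trans + (A ^ (-g.level)).1 *ᵥ h.trans, g.level + h.level⟩⟩

instance : One (DeckGroup A) := ⟨⟨0, 0⟩⟩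

instance : Inv (DeckGroup A) := ⟨fun g => ⟨-((A ^ g.level).1 *ᵥ g.trans), -g.level⟩⟩

@[simp] theorem mul_trans (g h : DeckGroup A) :
    (g * h).trans = g.trans + (A ^ (-g.level)).1 *ᵥ h.trans := rfl

@[simp] theorem mul_level (g h : DeckGroup A) : (g * h).level = g.level + h.level := rfl

@[simp] theorem one_trans : (1 : DeckGroup A).trans = 0 := rfl

@[simp] theorem one_level : (1 : DeckGroup A).level = 0 := rfl

@[simp] theorem inv_trans (g : DeckGroup A) : g⁻¹.trans = -((A ^ g.level).1 *ᵥ g.trans) := rfl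

@[simp] theorem inv_level (g : DeckGroup A) : g⁻¹.level = -g.level := rfl

instance : Group (DeckGroup A) := Group.ofLeftAxioms
  (fun g h k => by
    ext1
    · simp only [mul_trans, mul_level, neg_add, zpow_add, Units.val_mul, ← mulVec_mulVec,
        mulVec_add, add_assoc]
    · simp [add_assoc])
  (fun g => by ext1 <;> simp)
  (fun g => by ext1 <;> simp)

/-- The normal subgroup `ℤ²` of lattice translations. -/
def lattice (m : Fin 2 → ℤ) : DeckGroup A := ⟨m, 0⟩

/-- The deck transformation `(v, t) ↦ (A⁻¹ v, t + 1)`. -/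
def step : DeckGroup A := ⟨0, 1⟩

@[simp] theorem lattice_trans (m : Fin 2 → ℤ) : (lattice m : DeckGroup A).trans = m := rfl

@[simp] theorem lattice_level (m : Fin 2 → ℤ) : (lattice m : DeckGroup A).level = 0 := rfl

@[simp] theorem step_trans : (step : DeckGroup A).trans = 0 := rfl

@[simp] theorem step_level : (step : DeckGroup A).level = 1 := rfl

theorem lattice_add (m n : Fin 2 → ℤ) :
    (lattice (m + n) : DeckGroup A) = lattice m * lattice n := by
  ext1 <;> simp

theorem step_zpow (k : ℤ) : (step ^ k : DeckGroup A) = ⟨0, k⟩ := by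
  induction k with
  | zero => rfl
  | succ k ih => rw [zpow_add_one, ih]; ext1 <;> simp
  | pred k ih => rw [zpow_sub_one, ih]; ext1 <;> simp [sub_eq_add_neg]

theorem eq_lattice_mul_step_zpow (g : DeckGroup A) : g = lattice g.trans * step ^ g.level := by
  rw [step_zpow]
  ext1 <;> simp

theorem mul_lattice_mul_inv (g : DeckGroup A) (m : Fin 2 → ℤ) :
    g * lattice m * g⁻¹ = lattice ((A ^ (-g.level)).1 *ᵥ m) := by
  ext1
  · simp only [mul_trans, mul_level, lattice_trans, lattice_level, inv_trans, add_zero, mulVec_neg,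
      mulVec_mulVec, ← Units.val_mul, ← _root_.zpow_add, neg_add_cancel, zpow_zero, Units.val_one,
      one_mulVec, add_neg_cancel_comm]
  · simp

theorem eq_lattice_of_level_eq_zero {g : DeckGroup A} (h : g.level = 0) : g = lattice g.trans := by
  ext1 <;> simp [h]

/-- The projection `ℤ² ⋊ ℤ → ℤ`. -/
def levelHom (A : GL (Fin 2) ℤ) : DeckGroup A →* Multiplicative ℤ where
  toFun g := Multiplicative.ofAdd g.level
  map_one' := rfl
  map_mul' _ _ := rfl

theorem mulAut_ext {φ ψ : MulAut (DeckGroup A)} (h : ∀ m, φ (lattice m) = ψ (lattice m))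
    (h' : φ step = ψ step) : φ = ψ := by
  ext1 g
  rw [eq_lattice_mul_step_zpow g, map_mul, map_mul, h, map_zpow, map_zpow, h']

/-- A matrix with nonzero determinant hits all multiples of its determinant. -/
theorem exists_mulVec_eq_det_smul (C : Matrix (Fin 2) (Fin 2) ℤ) (m : Fin 2 → ℤ) :
    ∃ m', C *ᵥ m' = C.det • m :=
  ⟨C.adjugate *ᵥ m, by rw [mulVec_mulVec, mul_adjugate, smul_mulVec, one_mulVec]⟩

/-- Since `A⁻¹ - 1` is invertible over `ℚ`, the coinvariants of `ℤ²` are torsion, so that `ℤ²` is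
killed by every homomorphism to `ℤ`. -/
theorem apply_lattice_eq_one (hA : IsHyperbolicMatrix A)
    (ψ : DeckGroup A →* Multiplicative ℤ) (m : Fin 2 → ℤ) : ψ (lattice m) = 1 := by
  let L : (Fin 2 → ℤ) →+ ℤ :=
    AddMonoidHom.mk' (fun m => (ψ (lattice m)).toAdd) fun m n => by simp [lattice_add]
  have hL (n : Fin 2 → ℤ) : L (((A⁻¹).1 - 1) *ᵥ n) = 0 := by
    have := congrArg ψ (mul_lattice_mul_inv (A := A) step n)
    rw [map_mul, map_mul, map_inv, mul_right_comm, mul_inv_cancel, one_mul, step_level,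
      zpow_neg, zpow_one] at this
    rw [sub_mulVec, one_mulVec, map_sub, sub_eq_zero]
    exact congrArg Multiplicative.toAdd this.symm
  obtain ⟨n, hn⟩ := exists_mulVec_eq_det_smul ((A⁻¹).1 - 1) m
  have := hL n
  rw [hn, map_zsmul, smul_eq_mul] at this
  exact congrArg Multiplicative.ofAdd
    ((mul_eq_zero.mp this).resolve_left hA.det_inv_sub_one_ne_zero)

/-- Every automorphism acts on `ℤ² ⋊ ℤ → ℤ` through multiplication by a constant. -/
theorem level_apply (hA : IsHyperbolicMatrix A) (φ : MulAut (DeckGroup A)) (g : DeckGroup A) :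
    (φ g).level = g.level * (φ step).level := by
  let ψ := (levelHom A).comp φ.toMonoidHom
  have : ψ g = ψ step ^ g.level := by
    conv_lhs => rw [eq_lattice_mul_step_zpow g]
    rw [map_mul, apply_lattice_eq_one hA, one_mul, map_zpow]
  simpa [ψ, levelHom] using congrArg Multiplicative.toAdd this

/-- The constant by which an automorphism scales levels is a unit of `ℤ`, so its square is `1`. -/
theorem level_sq_apply (hA : IsHyperbolicMatrix A) (φ : MulAut (DeckGroup A)) (g : DeckGroup A) :
    ((φ ^ 2) g).level = g.level := by
  have h1 : (φ⁻¹ (φ step)).level = 1 := by rw [MulAut.inv_apply_self]; rfl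
  rw [level_apply hA] at h1
  rw [pow_two, MulAut.mul_apply, level_apply hA, level_apply hA, mul_assoc]
  rcases Int.isUnit_iff.mp (IsUnit.of_mul_eq_one _ h1) with h | h <;> simp [h]

/-- An automorphism that preserves levels acts on the lattice by a matrix commuting with `A`. -/
theorem exists_matrix {φ : MulAut (DeckGroup A)}
    (hφ : ∀ g, (φ g).level = g.level) :
    ∃ B : GL (Fin 2) ℤ, B * A = A * B ∧ ∀ m, φ (lattice m) = lattice (B.1 *ᵥ m) := by
  have key (ψ : MulAut (DeckGroup A)) (hψ : ∀ g, (ψ g).level = g.level) :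
      ∃ M : Matrix (Fin 2) (Fin 2) ℤ, ∀ m, ψ (lattice m) = lattice (M *ᵥ m) := by
    let L : (Fin 2 → ℤ) →+ (Fin 2 → ℤ) := AddMonoidHom.mk' (fun m => (ψ (lattice m)).trans)
      fun m n => by simp [lattice_add, hψ]
    refine ⟨LinearMap.toMatrix' L.toIntLinearMap, fun m => ?_⟩
    rw [LinearMap.toMatrix'_mulVec]
    exact eq_lattice_of_level_eq_zero (hψ _)
  obtain ⟨M, hM⟩ := key φ hφ
  obtain ⟨N, hN⟩ := key φ⁻¹ fun g => by
    rw [← hφ (φ⁻¹ g), MulAut.apply_inv_self]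
  have hinj : Function.Injective (lattice : _ → DeckGroup A) := fun m n h => congrArg trans h
  have hMN : M * N = 1 := ext_of_mulVec_single fun i => hinj (by
    rw [← mulVec_mulVec, ← hM, ← hN, MulAut.apply_inv_self, one_mulVec])
  have hcomm : A⁻¹ * ⟨M, N, hMN, mul_eq_one_comm.mp hMN⟩ =
      (⟨M, N, hMN, mul_eq_one_comm.mp hMN⟩ : GL (Fin 2) ℤ) * A⁻¹ := by
    refine Units.ext (ext_of_mulVec_single fun i => hinj ?_)
    have h := congrArg φ (mul_lattice_mul_inv (A := A) step (Pi.single i 1))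
    rw [map_mul, map_mul, map_inv, hM, hM, mul_lattice_mul_inv, hφ, step_level, zpow_neg,
      zpow_one] at h
    rwa [Units.val_mul, Units.val_mul, ← mulVec_mulVec, ← mulVec_mulVec]
  refine ⟨⟨M, N, hMN, mul_eq_one_comm.mp hMN⟩, ?_, hM⟩
  rw [inv_mul_eq_iff_eq_mul, ← mul_assoc, eq_mul_inv_iff_mul_eq] at hcomm
  exact hcomm

/-- An automorphism that is trivial on the lattice and on the quotient `ℤ` has an inner power: it
is a class in the coinvariants of `ℤ²`, which are finite. -/
theorem exists_pow_mem_range_conj (hA : IsHyperbolicMatrix A) {σ : MulAut (DeckGroup A)}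
    (h : ∀ m, σ (lattice m) = lattice m) (h' : (σ step).level = 1) :
    ∃ j : ℕ, 1 ≤ j ∧ σ ^ j ∈ (MulAut.conj : DeckGroup A →* _).range := by
  have hstep (j : ℕ) : (σ ^ j) step = lattice (j • (σ step).trans) * step := by
    induction j with
    | zero => ext1 <;> simp
    | succ j ih =>
      rw [pow_succ', MulAut.mul_apply, ih, map_mul, h]
      ext1
      · simp [add_mul]
      · simp [h']
  have hlat (j : ℕ) (m) : (σ ^ j) (lattice m) = lattice m := by
    induction j with
    | zero => rfl
    | succ j ih => rw [pow_succ', MulAut.mul_apply, ih, h]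
  set C := (A⁻¹).1 - 1 with hC
  have hdet : C.det ≠ 0 := hA.det_inv_sub_one_ne_zero
  -- The exponent `C.det ^ 2` is positive and annihilates `ℤ² / C ℤ²`; the sign of `m` comes from
  -- the fact that conjugation by `lattice m` changes `step` by `m - A⁻¹ m = -C m`.
  obtain ⟨m, hm⟩ := exists_mulVec_eq_det_smul C (-C.det • (σ step).trans)
  refine ⟨C.det.natAbs * C.det.natAbs, Nat.mul_pos (Int.natAbs_pos.mpr hdet)
    (Int.natAbs_pos.mpr hdet), lattice m, mulAut_ext (fun n => ?_) ?_⟩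
  · rw [hlat, MulAut.conj_apply]
    ext1 <;> simp
  · rw [hstep, MulAut.conj_apply, ← natCast_zsmul, Nat.cast_mul, Int.natAbs_mul_self']
    rw [hC, sub_mulVec, one_mulVec, ← hC, sub_eq_iff_eq_add] at hm
    ext1
    · simp only [mul_trans, mul_level, lattice_trans, lattice_level, step_trans, step_level,
        inv_trans, neg_zero, zero_add, zpow_zero, Units.val_one, one_mulVec, zpow_neg, zpow_one,
        mulVec_neg, hm, add_zero, mulVec_zero]
      module
    · simp

theorem normal_range_conj (G : Type*) [Group G] : (MulAut.conj : G →* MulAut G).range.Normal where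
  conj_mem := by
    rintro _ ⟨g, rfl⟩ φ
    exact ⟨φ g, by ext x; simp⟩

/-- The outer automorphism group of the deck group is a torsion group. -/
theorem exists_pow_mem_range_conj_of_mulAut (hA : IsHyperbolicMatrix A)
    (φ : MulAut (DeckGroup A)) :
    ∃ n : ℕ, 1 ≤ n ∧ φ ^ n ∈ (MulAut.conj : DeckGroup A →* _).range := by
  have := normal_range_conj (DeckGroup A)
  obtain ⟨B, hB, hφB⟩ := exists_matrix (level_sq_apply hA φ)
  obtain ⟨n, hn, l, hl⟩ := hA.exists_pow_eq_zpow hB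
  have hpow (k : ℕ) (m) : ((φ ^ 2) ^ k) (lattice m) = lattice ((B ^ k).1 *ᵥ m) := by
    induction k with
    | zero => simp
    | succ k ih =>
      rw [pow_succ' (φ ^ 2), MulAut.mul_apply, ih, hφB, mulVec_mulVec, pow_succ' B, Units.val_mul]
  have hlev (k : ℕ) (g) : (((φ ^ 2) ^ k) g).level = g.level := by
    induction k with
    | zero => rfl
    | succ k ih => rw [pow_succ', MulAut.mul_apply, level_sq_apply hA, ih]
  let σ : MulAut (DeckGroup A) := (φ ^ 2) ^ n * MulAut.conj (step ^ l)
  have hσ (m) : σ (lattice m) = lattice m := by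
    rw [MulAut.mul_apply, MulAut.conj_apply, mul_lattice_mul_inv, step_zpow, hpow, mulVec_mulVec,
      ← Units.val_mul, hl, ← _root_.zpow_add, add_neg_cancel, zpow_zero, Units.val_one, one_mulVec]
  have hσ' : (σ step).level = 1 := by
    rw [MulAut.mul_apply, hlev, MulAut.conj_apply]
    simp
  obtain ⟨j, hj, hmem⟩ := exists_pow_mem_range_conj hA hσ hσ'
  refine ⟨2 * (n * j), Nat.mul_pos two_pos (Nat.mul_pos hn hj), ?_⟩
  rw [← QuotientGroup.eq_one_iff] at hmem ⊢
  have h1 : ((MulAut.conj (step ^ l : DeckGroup A) : MulAut (DeckGroup A)) :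
      MulAut (DeckGroup A) ⧸ (MulAut.conj : DeckGroup A →* _).range) = 1 :=
    (QuotientGroup.eq_one_iff _).mpr ⟨_, rfl⟩
  rwa [QuotientGroup.mk_pow, QuotientGroup.mk_mul, h1, mul_one, ← QuotientGroup.mk_pow,
    ← pow_mul, ← pow_mul] at hmem

end DeckGroup

/-! ### The universal covering of the suspension -/

namespace DeckGroup

variable {A : GL (Fin 2) ℤ}

theorem map_intCast_mul_mulVec (M N : Matrix (Fin 2) (Fin 2) ℤ) (v : Fin 2 → ℝ) :
    ((M * N).map (Int.cast : ℤ → ℝ)).mulVec v =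
      (M.map Int.cast).mulVec ((N.map Int.cast).mulVec v) := by
  have : (M * N).map (Int.cast : ℤ → ℝ) = M.map Int.cast * N.map Int.cast :=
    Matrix.map_mul (f := Int.castRingHom ℝ)
  rw [this, Matrix.mulVec_mulVec]

theorem map_intCast_mulVec_intCast (M : Matrix (Fin 2) (Fin 2) ℤ) (m : Fin 2 → ℤ) :
    (M.map (Int.cast : ℤ → ℝ)).mulVec (fun i => (m i : ℝ)) = fun i => ((M.mulVec m i : ℤ) : ℝ) := by
  ext i
  simp [Matrix.mulVec, dotProduct]

instance : MulAction (DeckGroup A) ((Fin 2 → ℝ) × ℝ) where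
  smul g e := (((A ^ (-g.level)).1.map (Int.cast : ℤ → ℝ)).mulVec e.1 + fun i => (g.trans i : ℝ),
    e.2 + g.level)
  one_smul e := by
    change ((((A ^ (-0 : ℤ)).1.map (Int.cast : ℤ → ℝ)).mulVec e.1 + fun i => ((0 : ℤ) : ℝ)),
      e.2 + ((0 : ℤ) : ℝ)) = e
    ext1
    · ext i
      simp
    · simp
  mul_smul g h e := by
    ext1
    · change ((A ^ (-(g.level + h.level))).1.map (Int.cast : ℤ → ℝ)).mulVec e.1 +
          (fun i => ((g.trans + (A ^ (-g.level)).1.mulVec h.trans) i : ℝ)) =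
        ((A ^ (-g.level)).1.map (Int.cast : ℤ → ℝ)).mulVec
          (((A ^ (-h.level)).1.map (Int.cast : ℤ → ℝ)).mulVec e.1 + fun i => (h.trans i : ℝ)) +
          fun i => (g.trans i : ℝ)
      rw [neg_add, zpow_add, Units.val_mul, map_intCast_mul_mulVec, Matrix.mulVec_add,
        map_intCast_mulVec_intCast]
      ext i
      simp only [Pi.add_apply, Int.cast_add]
      ring
    · change e.2 + ((g.level + h.level : ℤ) : ℝ) = e.2 + h.level + g.level
      push_cast
      ring

theorem smul_fst (g : DeckGroup A) (e : (Fin 2 → ℝ) × ℝ) :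
    (g • e).1 = ((A ^ (-g.level)).1.map (Int.cast : ℤ → ℝ)).mulVec e.1 +
      fun i => (g.trans i : ℝ) := rfl

theorem smul_snd (g : DeckGroup A) (e : (Fin 2 → ℝ) × ℝ) : (g • e).2 = e.2 + g.level := rfl

theorem smul_lineMap (g : DeckGroup A) (s : ℝ) (x y : (Fin 2 → ℝ) × ℝ) :
    g • AffineMap.lineMap x y s = AffineMap.lineMap (g • x) (g • y) s := by
  simp only [AffineMap.lineMap_apply_module]
  ext1
  · simp only [smul_fst, Prod.fst_add, Prod.smul_fst, Matrix.mulVec_add, Matrix.mulVec_smul]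
    module
  · simp only [smul_snd, Prod.snd_add, Prod.smul_snd, smul_eq_mul]
    ring

/-- A nontrivial deck transformation moves every point by at least `1`: it changes the height `t` by
a nonzero integer or translates `v` by a nonzero integer vector. -/
theorem eq_one_of_dist_lt_one (g : DeckGroup A) (e : (Fin 2 → ℝ) × ℝ) (h : dist (g • e) e < 1) :
    g = 1 := by
  rw [Prod.dist_eq, max_lt_iff, dist_pi_lt_iff one_pos] at h
  have small {k : ℤ} {x : ℝ} (hk : dist (x + k) x < 1) : k = 0 := by
    rw [Real.dist_eq, add_sub_cancel_left] at hk
    exact Int.abs_lt_one_iff.mp (by exact_mod_cast hk)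
  have hlev : g.level = 0 := small h.2
  refine DeckGroup.ext (funext fun i => small (x := e.1 i) ?_) hlev
  simpa [smul_fst, hlev] using h.1 i

end DeckGroup

/-- The quotient map `ℝ² → 𝕋²`. -/
def torusMk (v : Fin 2 → ℝ) : UnitAddTorus (Fin 2) := fun i => (v i : UnitAddCircle)

theorem isOpenQuotientMap_torusMk : IsOpenQuotientMap torusMk :=
  IsOpenQuotientMap.piMap fun _ => QuotientAddGroup.isOpenQuotientMap_mk

theorem toralMap_torusMk (M : Matrix (Fin 2) (Fin 2) ℤ) (v : Fin 2 → ℝ) :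
    toralMap M (torusMk v) = torusMk ((M.map Int.cast).mulVec v) := by
  ext i
  simp [toralMap, torusMk, Matrix.mulVec, dotProduct, ← zsmul_eq_mul]

theorem torusMk_eq_iff {v w : Fin 2 → ℝ} :
    torusMk v = torusMk w ↔ ∃ m : Fin 2 → ℤ, v = w + fun i => (m i : ℝ) := by
  have key (x y : ℝ) : (x : UnitAddCircle) = y ↔ ∃ k : ℤ, x = y + k := by
    rw [← sub_eq_zero, ← AddCircle.coe_sub, AddCircle.coe_eq_zero_iff]
    refine exists_congr fun k => ?_
    rw [zsmul_one, eq_sub_iff_add_eq, add_comm, eq_comm]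
  simp only [funext_iff, torusMk, key, Pi.add_apply]
  exact Classical.skolem

/-- The map `ℝ² × ℝ → M_A`, which is the universal covering of the suspension. -/
def suspensionMk (A : GL (Fin 2) ℤ) (e : (Fin 2 → ℝ) × ℝ) : SuspensionManifold A :=
  Quot.mk _ (torusMk e.1, e.2)

/-- The iterated identification `(Aᵏ x, t) ∼ (x, t + k)`. -/
theorem suspension_mk_zpow (A : GL (Fin 2) ℤ) (k : ℤ) (x : UnitAddTorus (Fin 2)) (t : ℝ) :
    (Quot.mk _ (toralMap (A ^ k).1 x, t) : SuspensionManifold A) = Quot.mk _ (x, t + k) := by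
  have step (y : UnitAddTorus (Fin 2)) (s : ℝ) :
      (Quot.mk _ (toralMap A.1 y, s) : SuspensionManifold A) = Quot.mk _ (y, s + 1) :=
    Quot.sound (SuspensionRel.glue y s)
  induction k generalizing x t with
  | zero => simp [toralMap_one]
  | succ k ih =>
    rw [add_comm, zpow_add, zpow_one, Units.val_mul, toralMap_mul, step, ih]
    push_cast
    ring_nf
  | pred k ih =>
    have := step (toralMap (A ^ (-(k : ℤ) - 1)).1 x) (t - 1)
    rw [← toralMap_mul, ← Units.val_mul, ← zpow_one_add, add_sub_cancel, ih, sub_add_cancel] at this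
    rw [← this]
    push_cast
    ring_nf

theorem suspensionMk_eq_iff {A : GL (Fin 2) ℤ} {e e' : (Fin 2 → ℝ) × ℝ} :
    suspensionMk A e = suspensionMk A e' ↔ e ∈ MulAction.orbit (DeckGroup A) e' := by
  constructor
  · intro h
    suffices H : ∀ x y, Relation.EqvGen (SuspensionRel A) x y → ∀ e e' : (Fin 2 → ℝ) × ℝ,
        (torusMk e.1, e.2) = x → (torusMk e'.1, e'.2) = y →
        e ∈ MulAction.orbit (DeckGroup A) e' from H _ _ (Quot.eqvGen_exact h) e e' rfl rfl
    intro x y hxy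
    induction hxy with
    | rel x y h =>
      obtain ⟨x, t⟩ := h
      intro e e' he he'
      obtain ⟨h1, h2⟩ := Prod.mk.inj he
      obtain ⟨h3, h4⟩ := Prod.mk.inj he'
      have h1 : torusMk e.1 = toralMap A.1 x := h1
      rw [← h3, toralMap_torusMk, torusMk_eq_iff] at h1
      obtain ⟨m, hm⟩ := h1
      refine ⟨⟨m, -1⟩, Prod.ext ?_ ?_⟩
      · simp [DeckGroup.smul_fst, hm]
      · simp [DeckGroup.smul_snd, h2, h4]
    | refl x =>
      rintro e e' rfl he'
      obtain ⟨h1, h2⟩ := Prod.mk.inj he'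
      obtain ⟨m, hm⟩ := torusMk_eq_iff.mp h1.symm
      refine ⟨DeckGroup.lattice m, Prod.ext ?_ ?_⟩
      · simp [DeckGroup.smul_fst, hm]
      · simp [DeckGroup.smul_snd, h2]
    | symm x y _ ih => exact fun e e' he he' => MulAction.mem_orbit_symm.mp (ih e' e he' he)
    | trans x y z _ _ ih ih' =>
      intro e e' he he'
      obtain ⟨v, hv⟩ := isOpenQuotientMap_torusMk.surjective y.1
      have h1 := ih e (v, y.2) he (Prod.ext hv rfl)
      have h2 := ih' (v, y.2) e' (Prod.ext hv rfl) he'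
      rwa [MulAction.orbit_eq_iff.mpr h2] at h1
  · rintro ⟨g, rfl⟩
    change Quot.mk _ (torusMk (_ + _), e'.2 + (g.level : ℝ)) = Quot.mk _ _
    rw [torusMk_eq_iff.mpr ⟨g.trans, rfl⟩, ← toralMap_torusMk, ← suspension_mk_zpow,
      ← toralMap_mul, ← Units.val_mul, ← zpow_add, add_neg_cancel, zpow_zero, Units.val_one,
      toralMap_one]

theorem isQuotientCoveringMap_suspensionMk (A : GL (Fin 2) ℤ) :
    IsQuotientCoveringMap (suspensionMk A) (DeckGroup A) where
  toIsQuotientMap := isQuotientMap_quot_mk.comp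
    (isOpenQuotientMap_torusMk.prodMap IsOpenQuotientMap.id).isQuotientMap
  continuous_const_smul g := by
    have h : Continuous fun v : Fin 2 → ℝ =>
        ((A ^ (-g.level)).1.map (Int.cast : ℤ → ℝ)).mulVec v :=
      continuous_const.matrix_mulVec continuous_id
    exact ((h.comp continuous_fst).add continuous_const).prodMk
      (continuous_snd.add continuous_const)
  apply_eq_iff_mem_orbit := suspensionMk_eq_iff
  disjoint e := by
    refine ⟨Metric.ball e (1 / 2), Metric.ball_mem_nhds _ (by norm_num), fun g => ?_⟩
    rintro ⟨_, ⟨x, hx, rfl⟩, hgx⟩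
    refine g.eq_one_of_dist_lt_one x ?_
    have := dist_triangle_right (g • x) x e
    rw [Metric.mem_ball] at hx hgx
    linarith

theorem mainTheorem9 (A : GL (Fin 2) ℤ) (hA : IsHyperbolicMatrix A)
    (f : SuspensionManifold A ≃ₜ SuspensionManifold A) :
    ∃ n : ℕ, 1 ≤ n ∧
      ContinuousMap.Homotopic
        ((f ^ n : SuspensionManifold A ≃ₜ SuspensionManifold A) :
          C(SuspensionManifold A, SuspensionManifold A))
        (ContinuousMap.id (SuspensionManifold A)) :=
  (isQuotientCoveringMap_suspensionMk A).exists_pow_homotopic_id DeckGroup.smul_lineMap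
    (DeckGroup.exists_pow_mem_range_conj_of_mulAut hA) f
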